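/- **Theorem (limit of a peri-null Bayes factor).** Let $\Theta\subseteq\mathbb R^p$ be open and let $\{P_\theta:\theta\in\Theta\}$ be an identifiable family of distributions on $\mathbb R^k$ with densities $f(y\mid\theta)$ with respect to Lebesgue measure. Write $f(y^n\mid\theta)=\prod_{i=1}^n f(y_i\mid\theta)$ and $\ell_n(\theta)=\frac1n\sum_{i=1}^n\log f(y_i\mid\theta)$. Suppose that the family is *Laplace-regular*, that is, for every $\theta_0\in\Theta$: 1. for $P_{\theta_0}$-almost every $y$, $f(y\mid\theta)>0$ for all $\theta\in\Theta$ and $\theta\mapsto\log f(y\mid\theta)$ is six times continuously differentiable on $\Theta$; 2. there is a compact neighbourhood $K\subseteq\Theta$ of $\theta_0$ such that (a) for every $\theta_1\in K$ there are $\varepsilon>0$ and $M$ such that, for $P_{\theta_0}^{\infty}$-almost every sequence $(y_i)$ and all sufficiently large $n$, all derivatives of $\ell_n$ of orders $1,\dots,6$ are bounded in norm by $M$ on $B_\varepsilon(\theta_1)\cap\Theta$; and (b) there is $c>0$ such that, for $P_{\theta_0}^{\infty}$-almost every sequence and all sufficiently large $n$, $\ell_n(\theta)\le \ell_n(\theta_0)-c$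 for all $\theta\in\Theta\setminus K$; 3. there is $\zeta>0$ such that, for $P_{\theta_0}^{\infty}$-almost every sequence and all sufficiently large $n$, $\det\bigl(-D^2\ell_n(\hat\theta)\bigr)\ge\zeta$ at every maximum likelihood estimate $\hat\theta\in\Theta$ based on $y_1,\dots,y_n$. Let $Y_1,Y_2,\dots$ be independent and identically distributed with distribution $P_\theta$ for some $\theta\in\Theta$. Let $\pi(\cdot\mid\mathcal H_1)$ (alternative) and $\pi(\cdot\mid\mathcal H_{\widetilde 0})$ (peri-null) be prior densities on $\Theta$ with respect to Lebesgue measure, both positive and four times continuously differentiable at the data-governing $\theta$. (The priors may be improper, provided that, almost surely, the marginal likelihood below is finite for some sample size; for a prior that integrates to one this is automatic.) For $j\in\{1,\widetilde 0\}$ put $$p(Y^n\mid\mathcal H_j)=\int_\Theta f(Y^n\mid\vartheta)\,\pi(\vartheta\mid\mathcal H_j)\,d\vartheta,\qquad \mathrm{BF}_{1\widetilde 0}(Y^n)=\frac{p(Y^n\mid\mathcal H_1)}{p(Y^n\mid\mathcal H_{\widetilde 0})},\qquad \mathrm{BF}_{\widetilde 0 1}(Y^n)=\frac{p(Y^n\mid\mathcal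 H_{\widetilde 0})}{p(Y^n\mid\mathcal H_1)}.$$ Then, almost surely, both marginal likelihoods are finite and positive for all sufficiently large $n$, and $$\mathrm{BF}_{1\widetilde 0}(Y^n)\;\xrightarrow{\;P_\theta\;}\;\frac{\pi(\theta\mid\mathcal H_1)}{\pi(\theta\mid\mathcal H_{\widetilde 0})}\qquad(n\to\infty)$$ in probability. In particular the peri-null Bayes factor is inconsistent: neither $\mathrm{BF}_{1\widetilde 0}(Y^n)$ nor $\mathrm{BF}_{\widetilde 0 1}(Y^n)$ tends to zero in probability under $P_\theta$. -/

import Mathlib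

open Filter Topology MeasureTheory ProbabilityTheory

noncomputable section

/-- Parameters and observations live in Euclidean spaces `ℝ^p` and `ℝ^k`. -/
abbrev Eucl (m : ℕ) : Type := EuclideanSpace ℝ (Fin m)

/-- `f θ` (for `θ ∈ Θ`) is a probability density on `ℝ^k` with respect to Lebesgue measure, and the
parameter space `Θ ⊆ ℝ^p` is open. -/
structure IsParametricFamily {p k : ℕ} (Θ : Set (Eucl p)) (f : Eucl p → Eucl k → ℝ) : Prop where
  isOpen : IsOpen Θ
  measurable : ∀ θ ∈ Θ, Measurable (f θ)
  nonneg : ∀ θ ∈ Θ, ∀ y, 0 ≤ f θ y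
  lintegral_eq_one : ∀ θ ∈ Θ, ∫⁻ y, ENNReal.ofReal (f θ y) = 1

/-- The distribution `P_θ` of one observation. -/
def law {p k : ℕ} (f : Eucl p → Eucl k → ℝ) (θ : Eucl p) : Measure (Eucl k) :=
  volume.withDensity fun y => ENNReal.ofReal (f θ y)

/-- The distribution of an infinite sequence of independent observations from `P_θ`. -/
def seqLaw {p k : ℕ} (f : Eucl p → Eucl k → ℝ) (θ : Eucl p) : Measure (ℕ → Eucl k) :=
  Measure.infinitePi fun _ => law f θ

/-- Different parameters give different distributions. -/
def IsIdentifiable {p k : ℕ} (Θ : Set (Eucl p)) (f : Eucl p → Eucl k → ℝ) : Prop :=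
  Set.InjOn (law f) Θ

/-- Likelihood `f(y^n | θ)` of the first `n` observations. -/
def likelihood {p k : ℕ} (f : Eucl p → Eucl k → ℝ) (n : ℕ) (y : ℕ → Eucl k) (θ : Eucl p) : ℝ :=
  ∏ i ∈ Finset.range n, f θ (y i)

/-- Log-likelihood of the first `n` observations (used only where all the factors are positive). -/
def logLikelihood {p k : ℕ} (f : Eucl p → Eucl k → ℝ) (n : ℕ) (y : ℕ → Eucl k) (θ : Eucl p) : ℝ :=
  ∑ i ∈ Finset.range n, Real.log (f θ (y i))

/-- Average log-likelihood `n⁻¹ ∑ log f(y_i | θ)`. -/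
def avgLogLikelihood {p k : ℕ} (f : Eucl p → Eucl k → ℝ) (n : ℕ) (y : ℕ → Eucl k)
    (θ : Eucl p) : ℝ :=
  (n : ℝ)⁻¹ * logLikelihood f n y θ

/-- Observed Fisher information per observation: minus the Hessian matrix of the average
log-likelihood. -/
def observedInformation {p k : ℕ} (f : Eucl p → Eucl k → ℝ) (n : ℕ) (y : ℕ → Eucl k)
    (θ : Eucl p) : Matrix (Fin p) (Fin p) ℝ :=
  Matrix.of fun a b =>
    -iteratedFDeriv ℝ 2 (avgLogLikelihood f n y) θ
      ![EuclideanSpace.single a (1 : ℝ), EuclideanSpace.single b (1 : ℝ)]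

/-- `θhat` is a maximum likelihood estimate from the first `n` observations. -/
def IsMLE {p k : ℕ} (Θ : Set (Eucl p)) (f : Eucl p → Eucl k → ℝ) (n : ℕ) (y : ℕ → Eucl k)
    (θhat : Eucl p) : Prop :=
  θhat ∈ Θ ∧ IsMaxOn (likelihood f n y) Θ θhat

/-- Laplace regularity at the data-governing parameter `θ₀`: the log-density is six times
continuously differentiable in the parameter; and, for almost every sequence of observations from
`P_θ₀`, the average log-likelihoods have locally bounded derivatives up to order six on a compact
neighbourhood `K` of `θ₀`, stay bounded away from (below) their value at `θ₀` outside `K`, and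
have Hessians at the maximum likelihood estimates with determinant bounded away from zero.
Neither existence nor consistency of the maximum likelihood estimate is part of the definition. -/
structure IsLaplaceRegularAt {p k : ℕ} (Θ : Set (Eucl p)) (f : Eucl p → Eucl k → ℝ)
    (θ₀ : Eucl p) : Prop where
  smooth : ∀ᵐ y ∂(law f θ₀),
    (∀ θ ∈ Θ, 0 < f θ y) ∧ ContDiffOn ℝ 6 (fun θ => Real.log (f θ y)) Θ
  local_bounds_and_far_separation : ∃ K : Set (Eucl p), IsCompact K ∧ K ⊆ Θ ∧ K ∈ 𝓝 θ₀ ∧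
    (∀ θ₁ ∈ K, ∃ ε > 0, ∃ M : ℝ, ∀ᵐ y ∂(seqLaw f θ₀), ∀ᶠ n : ℕ in atTop,
      ∀ θ ∈ Metric.ball θ₁ ε ∩ Θ, ∀ d : ℕ, 1 ≤ d → d ≤ 6 →
        ‖iteratedFDeriv ℝ d (avgLogLikelihood f n y) θ‖ ≤ M) ∧
    (∃ c > 0, ∀ᵐ y ∂(seqLaw f θ₀), ∀ᶠ n : ℕ in atTop, ∀ θ ∈ Θ \ K,
      avgLogLikelihood f n y θ ≤ avgLogLikelihood f n y θ₀ - c)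
  hessian : ∃ ζ > 0, ∀ᵐ y ∂(seqLaw f θ₀), ∀ᶠ n : ℕ in atTop,
    ∀ θhat, IsMLE Θ f n y θhat → ζ ≤ (observedInformation f n y θhat).det

/-- A Laplace-regular family: the above at every possible data-governing parameter. -/
def IsLaplaceRegular {p k : ℕ} (Θ : Set (Eucl p)) (f : Eucl p → Eucl k → ℝ) : Prop :=
  ∀ θ₀ ∈ Θ, IsLaplaceRegularAt Θ f θ₀

/-- `π` is a prior density on `Θ`, with respect to Lebesgue measure, usable when the data come from
`P_θ₀`. It need not integrate to one: an improper prior is allowed as long as, almost surely, the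
marginal likelihood is finite for some sample size. When `π` is integrable over `Θ` (in particular,
a probability density), the last field holds automatically, with `n = 0`. -/
structure IsPriorDensity {p k : ℕ} (Θ : Set (Eucl p)) (f : Eucl p → Eucl k → ℝ) (θ₀ : Eucl p)
    (π : Eucl p → ℝ) : Prop where
  aemeasurable : AEMeasurable π (volume.restrict Θ)
  nonneg : ∀ θ ∈ Θ, 0 ≤ π θ
  finite_marginal : ∀ᵐ y ∂(seqLaw f θ₀), ∃ n : ℕ,
    IntegrableOn (fun θ => likelihood f n y θ * π θ) Θ

/-- Marginal likelihood `p(y^n | H) = ∫_Θ f(y^n | θ) π(θ | H) dθ`. -/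
def marginalLikelihood {p k : ℕ} (Θ : Set (Eucl p)) (f : Eucl p → Eucl k → ℝ) (π : Eucl p → ℝ)
    (n : ℕ) (y : ℕ → Eucl k) : ℝ :=
  ∫ θ in Θ, likelihood f n y θ * π θ

/-- Bayes factor of the hypothesis with prior density `π` against the one with prior density `π'`:
the ratio `p(y^n | π) / p(y^n | π')` of the marginal likelihoods. -/
def bayesFactor {p k : ℕ} (Θ : Set (Eucl p)) (f : Eucl p → Eucl k → ℝ) (π π' : Eucl p → ℝ)
    (n : ℕ) (y : ℕ → Eucl k) : ℝ :=
  marginalLikelihood Θ f π n y / marginalLikelihood Θ f π' n y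

/-- The marginal likelihood is a convergent integral with a positive value. -/
def HasProperMarginal {p k : ℕ} (Θ : Set (Eucl p)) (f : Eucl p → Eucl k → ℝ) (π : Eucl p → ℝ)
    (n : ℕ) (y : ℕ → Eucl k) : Prop :=
  IntegrableOn (fun θ => likelihood f n y θ * π θ) Θ ∧ 0 < marginalLikelihood Θ f π n y

end

/-!
The limit needs no Laplace expansion: it follows from exponential concentration of the likelihood
at the data-governing parameter `θ₀`, combined with continuity of the two priors there.

*Separation.* For `θ₁ ≠ θ₀` the two laws differ, so their Hellinger affinity is less than one
(`lintegral_sqrt_ratio_lt_one`) and a Borel–Cantelli argument makes the likelihood ratio decay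
exponentially, almost surely (`ae_eventually_likelihood_le`). The bound on the first derivative of
the average log-likelihood spreads this to a neighbourhood of `θ₁`, compactness spreads it to `K`
minus a ball around `θ₀`, and the far-separation hypothesis covers the rest of `Θ`
(`isSeparatedFrom_diff_ball`). The same derivative bound shows that near `θ₀` the likelihood drops
only at an arbitrarily small exponential rate (`ae_forall_eventually_le_likelihood`).

*Improper priors.* If the marginal likelihood is finite at the random sample size `m`, separation is
applied to the observations after the first `m`, which are again independent with the same law; the
remaining factor `likelihood f m y` is integrable against the prior
(`ae_forall_eventually_likelihood_le`).

*Conclusion.* Hence `∫_Θ f(y^n | θ) π(θ) dθ` is asymptotic to `π(θ₀) ∫_B f(y^n | θ) dθ` for a fixed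
ball `B` around `θ₀` (`ConcentratesAt.tendsto_integral_div`), and the last integral cancels in the
Bayes factor, which therefore converges almost surely. Convergence in probability follows because
the Bayes factor is measurable in the data up to a null set
(`aestronglyMeasurable_marginalLikelihood`).
-/

/-! ### The product law of the observations -/

theorem isProbabilityMeasure_law {p k : ℕ} {Θ : Set (Eucl p)} {f : Eucl p → Eucl k → ℝ}
    (hf : IsParametricFamily Θ f) {θ : Eucl p} (hθ : θ ∈ Θ) : IsProbabilityMeasure (law f θ) :=
  ⟨by rw [law, withDensity_apply _ MeasurableSet.univ, setLIntegral_univ,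
    hf.lintegral_eq_one θ hθ]⟩

/-- Discarding the first `m` observations does not change the law of the sequence. -/
theorem measurePreserving_shift {p k : ℕ} {f : Eucl p → Eucl k → ℝ} {θ : Eucl p}
    [IsProbabilityMeasure (law f θ)] (m : ℕ) :
    MeasurePreserving (fun (y : ℕ → Eucl k) i => y (m + i)) (seqLaw f θ) (seqLaw f θ) := by
  have hmeas : Measurable (fun (y : ℕ → Eucl k) i => y (m + i)) := by fun_prop
  refine ⟨hmeas, ?_⟩
  have hind : iIndepFun (fun i (y : ℕ → Eucl k) => y i) (seqLaw f θ) :=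
    iIndepFun_infinitePi (P := fun _ => law f θ) (X := fun _ x => x) (fun _ => measurable_id)
  have hind' : iIndepFun (fun i (y : ℕ → Eucl k) => y (m + i)) (seqLaw f θ) :=
    hind.precomp (g := fun i => m + i) (fun a b h => by simpa using h)
  rw [hind'.map_fun_eq_infinitePi_map (fun i => measurable_pi_apply _)]
  simp only [seqLaw]
  congr 1
  funext i
  exact (measurePreserving_eval_infinitePi (fun _ => law f θ) (m + i)).map_eq

/-- A property of almost every observation holds, almost surely, for all the observations. -/
theorem ae_seqLaw_forall {p k : ℕ} {f : Eucl p → Eucl k → ℝ} {θ : Eucl p}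
    [IsProbabilityMeasure (law f θ)] {q : Eucl k → Prop} (hq : ∀ᵐ x ∂(law f θ), q x) :
    ∀ᵐ y ∂(seqLaw f θ), ∀ i, q (y i) :=
  ae_all_iff.2 fun i =>
    (measurePreserving_eval_infinitePi (fun _ => law f θ) i).quasiMeasurePreserving.ae hq

theorem likelihood_add {p k : ℕ} (f : Eucl p → Eucl k → ℝ) (m n : ℕ) (y : ℕ → Eucl k)
    (θ : Eucl p) :
    likelihood f (m + n) y θ = likelihood f m y θ * likelihood f n (fun i => y (m + i)) θ :=
  Finset.prod_range_add _ _ _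

theorem likelihood_pos {p k : ℕ} {f : Eucl p → Eucl k → ℝ} {n : ℕ} {y : ℕ → Eucl k}
    {θ : Eucl p} (h : ∀ i, 0 < f θ (y i)) : 0 < likelihood f n y θ :=
  Finset.prod_pos fun i _ => h i

theorem likelihood_eq_exp {p k : ℕ} {f : Eucl p → Eucl k → ℝ} {n : ℕ} {y : ℕ → Eucl k}
    {θ : Eucl p} (h : ∀ i, 0 < f θ (y i)) :
    likelihood f n y θ = Real.exp (n * avgLogLikelihood f n y θ) := by
  rcases Nat.eq_zero_or_pos n with rfl | hn
  · simp [likelihood]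
  · have hn' : (n : ℝ) ≠ 0 := by positivity
    rw [avgLogLikelihood, mul_inv_cancel_left₀ hn', logLikelihood, Real.exp_sum]
    exact Finset.prod_congr rfl fun i _ => (Real.exp_log (h i)).symm

/-! ### Separation of two distinct parameters -/

/-- The Hellinger affinity `∫ √(f_θ₁ f_θ₀)` of two distinct laws is strictly less than one, being
bounded by the integral of the arithmetic mean with equality only when the densities agree. -/
theorem lintegral_sqrt_ratio_lt_one {p k : ℕ} {Θ : Set (Eucl p)} {f : Eucl p → Eucl k → ℝ}
    (hf : IsParametricFamily Θ f) {θ₀ θ₁ : Eucl p} (h₀ : θ₀ ∈ Θ) (h₁ : θ₁ ∈ Θ)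
    (hne : law f θ₁ ≠ law f θ₀) :
    ∫⁻ x, ENNReal.ofReal √(f θ₁ x / f θ₀ x) ∂(law f θ₀) < 1 := by
  have m₀ := hf.measurable θ₀ h₀
  have m₁ := hf.measurable θ₁ h₁
  have n₀ := hf.nonneg θ₀ h₀
  have n₁ := hf.nonneg θ₁ h₁
  have e1 : ∫⁻ x, ENNReal.ofReal √(f θ₁ x / f θ₀ x) ∂(law f θ₀)
      = ∫⁻ x, ENNReal.ofReal (√(f θ₀ x) * √(f θ₁ x)) := by
    rw [law, lintegral_withDensity_eq_lintegral_mul _ (by fun_prop) (by fun_prop)]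
    refine lintegral_congr fun x => ?_
    rw [Pi.mul_apply, ← ENNReal.ofReal_mul (n₀ x), Real.sqrt_div (n₁ x)]
    congr 1
    rcases (n₀ x).eq_or_lt with h | h
    · simp [← h]
    · have := Real.sqrt_pos.2 h
      have h2 := Real.sq_sqrt h.le
      field_simp
      rw [h2, mul_comm]
  have e2 : ∫⁻ x, ENNReal.ofReal ((f θ₀ x + f θ₁ x) / 2) = 1 := by
    have : ∀ x, ENNReal.ofReal ((f θ₀ x + f θ₁ x) / 2)
        = (ENNReal.ofReal (f θ₀ x) + ENNReal.ofReal (f θ₁ x)) * ENNReal.ofReal 2⁻¹ := fun x => by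
      rw [← ENNReal.ofReal_add (n₀ x) (n₁ x), ← ENNReal.ofReal_mul (add_nonneg (n₀ x) (n₁ x)),
        div_eq_mul_inv]
    simp_rw [this]
    rw [lintegral_mul_const _ (by fun_prop), lintegral_add_left (by fun_prop),
      hf.lintegral_eq_one θ₀ h₀, hf.lintegral_eq_one θ₁ h₁, one_add_one_eq_two,
      ENNReal.ofReal_inv_of_pos two_pos, ENNReal.ofReal_ofNat,
      ENNReal.mul_inv_cancel (by simp) (by simp)]
  have hle : ∀ x, ENNReal.ofReal (√(f θ₀ x) * √(f θ₁ x))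
      ≤ ENNReal.ofReal ((f θ₀ x + f θ₁ x) / 2) := fun x => by
    refine ENNReal.ofReal_le_ofReal ?_
    nlinarith [sq_nonneg (√(f θ₀ x) - √(f θ₁ x)), Real.sq_sqrt (n₀ x), Real.sq_sqrt (n₁ x)]
  rw [e1]
  by_contra hcon
  rw [not_lt] at hcon
  have hfin : ∫⁻ x, ENNReal.ofReal (√(f θ₀ x) * √(f θ₁ x)) ≠ ⊤ :=
    ((lintegral_mono hle).trans_lt (by rw [e2]; exact ENNReal.one_lt_top)).ne
  have hae := ae_eq_of_ae_le_of_lintegral_le (ae_of_all _ hle) hfin (by fun_prop)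
    (by rw [e2]; exact hcon)
  refine hne (withDensity_congr_ae ?_)
  filter_upwards [hae] with x hx
  rw [ENNReal.ofReal_eq_ofReal_iff (by positivity) (by linarith [n₀ x, n₁ x])] at hx
  have hz : (√(f θ₀ x) - √(f θ₁ x)) ^ 2 = 0 := by
    nlinarith [Real.sq_sqrt (n₀ x), Real.sq_sqrt (n₁ x)]
  have hs : √(f θ₀ x) = √(f θ₁ x) := sub_eq_zero.1 (pow_eq_zero_iff two_ne_zero |>.1 hz)
  rw [← Real.sq_sqrt (n₀ x), ← Real.sq_sqrt (n₁ x), hs]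

/-- Almost surely the likelihood ratio of a wrong parameter against the true one decays
exponentially: the expected square root of the ratio is the `n`-th power of the affinity, and the
Borel–Cantelli argument is run on these square roots, so that no integrability of log-likelihood
ratios is needed. -/
theorem ae_eventually_likelihood_le {p k : ℕ} {Θ : Set (Eucl p)} {f : Eucl p → Eucl k → ℝ}
    (hf : IsParametricFamily Θ f) {θ₀ θ₁ : Eucl p} (h₀ : θ₀ ∈ Θ) (h₁ : θ₁ ∈ Θ)
    (hne : law f θ₁ ≠ law f θ₀) (hpos : ∀ᵐ x ∂(law f θ₀), 0 < f θ₀ x) :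
    ∃ c > 0, ∀ᵐ y ∂(seqLaw f θ₀), ∀ᶠ n : ℕ in atTop,
      likelihood f n y θ₁ ≤ Real.exp (-c * n) * likelihood f n y θ₀ := by
  have := isProbabilityMeasure_law hf h₀
  have m₀ := hf.measurable θ₀ h₀
  have m₁ := hf.measurable θ₁ h₁
  obtain ⟨t, ht0, hρt, ht1⟩ := ENNReal.lt_iff_exists_real_btwn.1
    (lintegral_sqrt_ratio_lt_one hf h₀ h₁ hne)
  set ρ := ∫⁻ x, ENNReal.ofReal √(f θ₁ x / f θ₀ x) ∂(law f θ₀) with hρ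
  have ht1' : t < 1 := by simpa using ht1
  have htpos : 0 < t := by
    rcases ht0.eq_or_lt with h | h
    · simp [← h] at hρt
    · exact h
  have htE : ENNReal.ofReal t ≠ 0 := by simpa using htpos
  let X : ℕ → (ℕ → Eucl k) → ENNReal := fun i y => ENNReal.ofReal √(f θ₁ (y i) / f θ₀ (y i))
  have hXm : ∀ i, Measurable (X i) := fun i => by
    have a := m₁.comp (measurable_pi_apply (X := fun _ : ℕ => Eucl k) i)
    have b := m₀.comp (measurable_pi_apply (X := fun _ : ℕ => Eucl k) i)
    exact (a.div b).sqrt.ennreal_ofReal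
  have hXi : iIndepFun X (seqLaw f θ₀) :=
    iIndepFun_infinitePi (P := fun _ => law f θ₀)
      (X := fun _ x => ENNReal.ofReal √(f θ₁ x / f θ₀ x)) (fun _ => by fun_prop)
  have hXint : ∀ i, ∫⁻ y, X i y ∂(seqLaw f θ₀) = ρ := fun i =>
    (measurePreserving_eval_infinitePi (fun _ => law f θ₀) i).lintegral_comp
      (f := fun x => ENNReal.ofReal √(f θ₁ x / f θ₀ x)) (by fun_prop)
  let Z : ℕ → (ℕ → Eucl k) → ENNReal :=
    fun n y => (∏ i ∈ Finset.range n, X i y) * (ENNReal.ofReal t)⁻¹ ^ n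
  have hPm : ∀ n, Measurable fun y => ∏ i ∈ Finset.range n, X i y :=
    fun n => Finset.measurable_fun_prod _ fun i _ => hXm i
  have hZm : ∀ n, Measurable (Z n) := fun n => (hPm n).mul_const _
  have hZint : ∀ n, ∫⁻ y, Z n y ∂(seqLaw f θ₀) = (ρ * (ENNReal.ofReal t)⁻¹) ^ n := fun n => by
    rw [lintegral_mul_const _ (hPm n), lintegral_prod_eq_prod_lintegral_of_indepFun _ X hXi hXm]
    simp [hXint, mul_pow]
  have hlt : ρ * (ENNReal.ofReal t)⁻¹ < 1 := by
    rw [← div_eq_mul_inv]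
    exact (ENNReal.div_lt_iff (Or.inl htE) (Or.inl ENNReal.ofReal_ne_top)).2 (by rwa [one_mul])
  have hsum : ∫⁻ y, ∑' n, Z n y ∂(seqLaw f θ₀) ≠ ⊤ := by
    rw [lintegral_tsum fun n => (hZm n).aemeasurable]
    simp_rw [hZint]
    rw [ENNReal.tsum_geometric]
    exact ENNReal.inv_ne_top.2 (tsub_pos_of_lt hlt).ne'
  refine ⟨-(2 * Real.log t), by linarith [Real.log_neg htpos ht1'], ?_⟩
  filter_upwards [ae_lt_top (Measurable.tsum hZm) hsum, ae_seqLaw_forall hpos]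
    with y hy hy0
  have hev : ∀ᶠ n in atTop, Z n y ≤ 1 :=
    ((ENNReal.tendsto_atTop_zero_of_tsum_ne_top hy.ne).eventually_lt_const one_pos).mono
      fun _ h => h.le
  filter_upwards [hev] with n hn
  have hle : ∏ i ∈ Finset.range n, √(f θ₁ (y i) / f θ₀ (y i)) ≤ t ^ n := by
    have h2 : ∏ i ∈ Finset.range n, X i y ≤ ENNReal.ofReal t ^ n := by
      simp only [Z, ← ENNReal.inv_pow] at hn
      rw [← div_eq_mul_inv] at hn
      have := (ENNReal.div_le_iff (pow_ne_zero n htE) (by finiteness)).1 hn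
      rwa [one_mul] at this
    simp only [X] at h2
    rw [← ENNReal.ofReal_prod_of_nonneg fun i _ => Real.sqrt_nonneg _,
      ← ENNReal.ofReal_pow ht0] at h2
    exact (ENNReal.ofReal_le_ofReal_iff (by positivity)).1 h2
  have hsq : (∏ i ∈ Finset.range n, √(f θ₁ (y i) / f θ₀ (y i))) ^ 2
      = likelihood f n y θ₁ / likelihood f n y θ₀ := by
    rw [← Finset.prod_pow, likelihood, likelihood, ← Finset.prod_div_distrib]
    exact Finset.prod_congr rfl fun i _ =>
      Real.sq_sqrt (div_nonneg (hf.nonneg _ h₁ _) (hy0 i).le)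
  have hexp : Real.exp (-(-(2 * Real.log t)) * n) = (t ^ n) ^ 2 := by
    rw [← pow_mul, ← Real.exp_log (pow_pos htpos (n * 2)), Real.log_pow]
    congr 1
    push_cast
    ring
  rw [hexp, ← div_le_iff₀ (likelihood_pos hy0), ← hsq]
  exact pow_le_pow_left₀ (Finset.prod_nonneg fun i _ => Real.sqrt_nonneg _) hle 2

/-! ### Uniform separation away from the true parameter -/

theorem differentiableOn_avgLogLikelihood {p k : ℕ} {Θ : Set (Eucl p)} {f : Eucl p → Eucl k → ℝ}
    {y : ℕ → Eucl k} (hy : ∀ i, ContDiffOn ℝ 6 (fun θ => Real.log (f θ (y i))) Θ) (n : ℕ) :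
    DifferentiableOn ℝ (avgLogLikelihood f n y) Θ := by
  unfold avgLogLikelihood logLikelihood
  exact (DifferentiableOn.fun_sum fun i _ => (hy i).differentiableOn (by norm_num)).const_mul _

theorem continuousOn_likelihood {p k : ℕ} {Θ : Set (Eucl p)} {f : Eucl p → Eucl k → ℝ}
    {y : ℕ → Eucl k} (hpos : ∀ i, ∀ θ ∈ Θ, 0 < f θ (y i))
    (hy : ∀ i, ContDiffOn ℝ 6 (fun θ => Real.log (f θ (y i))) Θ) (n : ℕ) :
    ContinuousOn (likelihood f n y) Θ :=
  ((continuousOn_const.mul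
    (differentiableOn_avgLogLikelihood hy n).continuousOn).rexp).congr
      fun _ hθ => likelihood_eq_exp fun i => hpos i _ hθ

/-- Almost surely, all the observations give positive likelihoods that are smooth in the
parameter. -/
theorem IsLaplaceRegularAt.ae_smooth {p k : ℕ} {Θ : Set (Eucl p)} {f : Eucl p → Eucl k → ℝ}
    {θ₀ : Eucl p} [IsProbabilityMeasure (law f θ₀)] (hreg : IsLaplaceRegularAt Θ f θ₀) :
    ∀ᵐ y ∂(seqLaw f θ₀), (∀ i, ∀ θ ∈ Θ, 0 < f θ (y i)) ∧
      ∀ i, ContDiffOn ℝ 6 (fun θ => Real.log (f θ (y i))) Θ := by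
  filter_upwards [ae_seqLaw_forall hreg.smooth] with y hy
  exact ⟨fun i => (hy i).1, fun i => (hy i).2⟩

/-- The bound on the first derivative makes the average log-likelihoods eventually Lipschitz near
`θ₁`, with a constant that does not depend on the sample size. -/
theorem exists_ae_eventually_lipschitz {p k : ℕ} {Θ : Set (Eucl p)} {f : Eucl p → Eucl k → ℝ}
    (hΘ : IsOpen Θ) {θ₀ θ₁ : Eucl p} [IsProbabilityMeasure (law f θ₀)]
    (hreg : IsLaplaceRegularAt Θ f θ₀) (h₁ : θ₁ ∈ Θ)
    (hb : ∃ ε > 0, ∃ M : ℝ, ∀ᵐ y ∂(seqLaw f θ₀), ∀ᶠ n : ℕ in atTop,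
      ∀ θ ∈ Metric.ball θ₁ ε ∩ Θ, ∀ d : ℕ, 1 ≤ d → d ≤ 6 →
        ‖iteratedFDeriv ℝ d (avgLogLikelihood f n y) θ‖ ≤ M) :
    ∃ ε > 0, ∃ M > 0, Metric.ball θ₁ ε ⊆ Θ ∧ ∀ᵐ y ∂(seqLaw f θ₀), ∀ᶠ n : ℕ in atTop,
      ∀ θ ∈ Metric.ball θ₁ ε,
        |avgLogLikelihood f n y θ - avgLogLikelihood f n y θ₁| ≤ M * dist θ θ₁ := by
  obtain ⟨ε, hε, M, hM⟩ := hb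
  obtain ⟨δ, hδ, hδΘ⟩ := Metric.isOpen_iff.1 hΘ θ₁ h₁
  have hsub : Metric.ball θ₁ (min ε δ) ⊆ Θ :=
    (Metric.ball_subset_ball (min_le_right _ _)).trans hδΘ
  refine ⟨min ε δ, lt_min hε hδ, max M 1, lt_max_of_lt_right one_pos, hsub, ?_⟩
  filter_upwards [hM, hreg.ae_smooth] with y hy hs
  filter_upwards [hy] with n hn θ hθ
  have hd := differentiableOn_avgLogLikelihood hs.2 n
  rw [dist_eq_norm, ← Real.norm_eq_abs]
  refine (convex_ball θ₁ (min ε δ)).norm_image_sub_le_of_norm_fderiv_le (𝕜 := ℝ)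
    (fun x hx => (hd x (hsub hx)).differentiableAt (hΘ.mem_nhds (hsub hx)))
    (fun x hx => ?_) (Metric.mem_ball_self (lt_min hε hδ)) hθ
  rw [← norm_iteratedFDeriv_one]
  exact (hn x ⟨Metric.ball_subset_ball (min_le_left _ _) hx, hsub hx⟩ 1 le_rfl
    (by norm_num)).trans (le_max_left _ _)

/-- Almost surely, and eventually in the sample size, the average log-likelihood is smaller on `S`
than at `θ₀` by at least a fixed amount. -/
def IsSeparatedFrom {p k : ℕ} (f : Eucl p → Eucl k → ℝ) (θ₀ : Eucl p) (S : Set (Eucl p)) : Prop :=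
  ∃ c > 0, ∀ᵐ y ∂(seqLaw f θ₀), ∀ᶠ n : ℕ in atTop, ∀ θ ∈ S,
    avgLogLikelihood f n y θ ≤ avgLogLikelihood f n y θ₀ - c

theorem IsSeparatedFrom.mono {p k : ℕ} {f : Eucl p → Eucl k → ℝ} {θ₀ : Eucl p}
    {S T : Set (Eucl p)} (hST : S ⊆ T) (h : IsSeparatedFrom f θ₀ T) : IsSeparatedFrom f θ₀ S := by
  obtain ⟨c, hc, h⟩ := h
  exact ⟨c, hc, h.mono fun _ hy => hy.mono fun _ hn θ hθ => hn θ (hST hθ)⟩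

theorem IsSeparatedFrom.union {p k : ℕ} {f : Eucl p → Eucl k → ℝ} {θ₀ : Eucl p}
    {S T : Set (Eucl p)} (hS : IsSeparatedFrom f θ₀ S) (hT : IsSeparatedFrom f θ₀ T) :
    IsSeparatedFrom f θ₀ (S ∪ T) := by
  obtain ⟨c, hc, hS⟩ := hS
  obtain ⟨d, hd, hT⟩ := hT
  refine ⟨min c d, lt_min hc hd, ?_⟩
  filter_upwards [hS, hT] with y h1 h2
  filter_upwards [h1, h2] with n h1 h2 θ hθ
  rcases hθ with hθ | hθ
  · linarith [h1 θ hθ, min_le_left c d]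
  · linarith [h2 θ hθ, min_le_right c d]

/-- Every wrong parameter has a neighbourhood separated from the true one: identifiability gives
separation at the point, and the Lipschitz bound spreads it. -/
theorem exists_nhds_isSeparatedFrom {p k : ℕ} {Θ : Set (Eucl p)} {f : Eucl p → Eucl k → ℝ}
    (hf : IsParametricFamily Θ f) {θ₀ θ₁ : Eucl p} (h₀ : θ₀ ∈ Θ) (h₁ : θ₁ ∈ Θ)
    (hne : law f θ₁ ≠ law f θ₀) (hreg : IsLaplaceRegularAt Θ f θ₀)
    (hb : ∃ ε > 0, ∃ M : ℝ, ∀ᵐ y ∂(seqLaw f θ₀), ∀ᶠ n : ℕ in atTop,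
      ∀ θ ∈ Metric.ball θ₁ ε ∩ Θ, ∀ d : ℕ, 1 ≤ d → d ≤ 6 →
        ‖iteratedFDeriv ℝ d (avgLogLikelihood f n y) θ‖ ≤ M) :
    ∃ U ∈ 𝓝 θ₁, IsSeparatedFrom f θ₀ U := by
  have := isProbabilityMeasure_law hf h₀
  obtain ⟨ε, hε, M, hM, -, hlip⟩ := exists_ae_eventually_lipschitz hf.isOpen hreg h₁ hb
  obtain ⟨c, hc, hsep⟩ := ae_eventually_likelihood_le hf h₀ h₁ hne
    (hreg.smooth.mono fun _ h => h.1 θ₀ h₀)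
  have hr : 0 < min ε (c / (2 * M)) := lt_min hε (by positivity)
  refine ⟨Metric.ball θ₁ (min ε (c / (2 * M))), Metric.ball_mem_nhds _ hr, c / 2, by positivity, ?_⟩
  filter_upwards [hlip, hsep, hreg.ae_smooth] with y hl hs hpos
  filter_upwards [hl, hs, eventually_gt_atTop 0] with n hl hs hn θ hθ
  have hd : M * dist θ θ₁ ≤ c / 2 := by
    have : dist θ θ₁ < c / (2 * M) := (Metric.mem_ball.1 hθ).trans_le (min_le_right _ _)
    rw [lt_div_iff₀ (by positivity)] at this
    linarith
  have h3 : avgLogLikelihood f n y θ₁ ≤ avgLogLikelihood f n y θ₀ - c := by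
    rw [likelihood_eq_exp fun i => hpos.1 i θ₁ h₁, likelihood_eq_exp fun i => hpos.1 i θ₀ h₀,
      ← Real.exp_add, Real.exp_le_exp] at hs
    have hn' : (0 : ℝ) < n := by exact_mod_cast hn
    refine le_of_mul_le_mul_left ?_ hn'
    linarith
  have h4 := (abs_le.1 (hl θ (Metric.ball_subset_ball (min_le_left _ _) hθ))).2
  linarith

/-- The complement of any ball around the true parameter is separated from it. -/
theorem isSeparatedFrom_diff_ball {p k : ℕ} {Θ : Set (Eucl p)} {f : Eucl p → Eucl k → ℝ}
    (hf : IsParametricFamily Θ f) (hid : IsIdentifiable Θ f) {θ₀ : Eucl p} (h₀ : θ₀ ∈ Θ)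
    (hreg : IsLaplaceRegularAt Θ f θ₀) {r : ℝ} (hr : 0 < r) :
    IsSeparatedFrom f θ₀ (Θ \ Metric.ball θ₀ r) := by
  obtain ⟨K, hK, hKΘ, -, hb, hfar⟩ := hreg.local_bounds_and_far_separation
  have hnear : IsSeparatedFrom f θ₀ (K \ Metric.ball θ₀ r) := by
    refine (hK.diff Metric.isOpen_ball).induction_on (p := IsSeparatedFrom f θ₀)
      ⟨1, one_pos, by simp⟩ (fun S T hST hT => hT.mono hST) (fun S T hS hT => hS.union hT) ?_
    rintro θ₁ ⟨hθK, hθr⟩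
    have hne : law f θ₁ ≠ law f θ₀ := fun h => by
      rw [hid (hKΘ hθK) h₀ h] at hθr
      exact hθr (Metric.mem_ball_self hr)
    obtain ⟨U, hU, hsep⟩ := exists_nhds_isSeparatedFrom hf h₀ (hKΘ hθK) hne hreg (hb θ₁ hθK)
    exact ⟨U, mem_nhdsWithin_of_mem_nhds hU, hsep⟩
  refine (hnear.union (T := Θ \ K) hfar).mono ?_
  rintro θ ⟨hθ, hθr⟩
  by_cases hθK : θ ∈ K
  · exact Or.inl ⟨hθK, hθr⟩
  · exact Or.inr ⟨hθ, hθK⟩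

/-- Almost surely, for every starting index `m` the likelihoods outside any ball around `θ₀` are
exponentially small compared with those at `θ₀`, relative to the likelihood of the first `m`
observations. Running the separation bound on the shifted sequence keeps the factor
`likelihood f m y θ`, which is what makes improper priors integrable. -/
theorem ae_forall_eventually_likelihood_le {p k : ℕ} {Θ : Set (Eucl p)} {f : Eucl p → Eucl k → ℝ}
    (hf : IsParametricFamily Θ f) (hid : IsIdentifiable Θ f) {θ₀ : Eucl p} (h₀ : θ₀ ∈ Θ)
    (hreg : IsLaplaceRegularAt Θ f θ₀) :
    ∀ᵐ y ∂(seqLaw f θ₀), ∀ r > 0, ∃ c > 0, ∀ m, ∃ C, ∀ᶠ n : ℕ in atTop,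
      ∀ θ ∈ Θ \ Metric.ball θ₀ r, likelihood f n y θ
        ≤ C * Real.exp (-c * n) * likelihood f n y θ₀ * likelihood f m y θ := by
  have := isProbabilityMeasure_law hf h₀
  choose c hc hsep using fun j : ℕ =>
    isSeparatedFrom_diff_ball hf hid h₀ hreg (r := 1 / ((j : ℝ) + 1)) (by positivity)
  have hshift : ∀ᵐ y ∂(seqLaw f θ₀), ∀ j m : ℕ, ∀ᶠ n : ℕ in atTop,
      ∀ θ ∈ Θ \ Metric.ball θ₀ (1 / ((j : ℝ) + 1)),
        avgLogLikelihood f n (fun i => y (m + i)) θ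
          ≤ avgLogLikelihood f n (fun i => y (m + i)) θ₀ - c j :=
    ae_all_iff.2 fun j => ae_all_iff.2 fun m =>
      (measurePreserving_shift m).quasiMeasurePreserving.ae (hsep j)
  filter_upwards [hshift, hreg.ae_smooth] with y hy hs r hr
  obtain ⟨j, hj⟩ := exists_nat_one_div_lt hr
  refine ⟨c j, hc j, fun m => ⟨Real.exp (c j * m) / likelihood f m y θ₀, ?_⟩⟩
  have hLm : 0 < likelihood f m y θ₀ := likelihood_pos fun i => hs.1 i θ₀ h₀
  have hev := hy j m
  rw [← map_add_atTop_eq_nat m, eventually_map]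
  filter_upwards [hev] with n hn θ hθ
  rw [add_comm n m]
  have hLθ : 0 < likelihood f m y θ := likelihood_pos fun i => hs.1 i θ hθ.1
  have h1 := hn θ ⟨hθ.1, fun h => hθ.2 (Metric.ball_subset_ball hj.le h)⟩
  have h2 : likelihood f n (fun i => y (m + i)) θ
      ≤ Real.exp (-c j * n) * likelihood f n (fun i => y (m + i)) θ₀ := by
    rw [likelihood_eq_exp fun i => hs.1 (m + i) θ hθ.1,
      likelihood_eq_exp fun i => hs.1 (m + i) θ₀ h₀, ← Real.exp_add, Real.exp_le_exp]
    nlinarith [mul_le_mul_of_nonneg_left h1 (Nat.cast_nonneg (α := ℝ) n)]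
  have h3 : Real.exp (-c j * ((m + n : ℕ) : ℝ)) = Real.exp (-c j * n) / Real.exp (c j * m) := by
    rw [← Real.exp_sub]
    congr 1
    push_cast
    ring
  rw [likelihood_add f m n y θ, likelihood_add f m n y θ₀, h3]
  calc likelihood f m y θ * likelihood f n (fun i => y (m + i)) θ
      ≤ likelihood f m y θ
        * (Real.exp (-c j * n) * likelihood f n (fun i => y (m + i)) θ₀) := by gcongr
    _ = _ := by
      have := Real.exp_pos (c j * m)
      field_simp

/-- Almost surely the likelihood near `θ₀` is not smaller than at `θ₀` by more than an
exponential factor of arbitrarily small rate. -/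
theorem ae_forall_eventually_le_likelihood {p k : ℕ} {Θ : Set (Eucl p)} {f : Eucl p → Eucl k → ℝ}
    (hf : IsParametricFamily Θ f) {θ₀ : Eucl p} (h₀ : θ₀ ∈ Θ)
    (hreg : IsLaplaceRegularAt Θ f θ₀) :
    ∀ᵐ y ∂(seqLaw f θ₀), ∀ δ > 0, ∃ r > 0, ∀ᶠ n : ℕ in atTop,
      ∀ θ ∈ Metric.ball θ₀ r, Real.exp (-δ * n) * likelihood f n y θ₀ ≤ likelihood f n y θ := by
  have := isProbabilityMeasure_law hf h₀
  obtain ⟨K, -, hKΘ, hK0, hb, -⟩ := hreg.local_bounds_and_far_separation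
  obtain ⟨ε, hε, M, hM, hεΘ, hlip⟩ := exists_ae_eventually_lipschitz hf.isOpen hreg h₀
    (hb θ₀ (mem_of_mem_nhds hK0))
  filter_upwards [hlip, hreg.ae_smooth] with y hl hs δ hδ
  refine ⟨min ε (δ / M), lt_min hε (by positivity), ?_⟩
  filter_upwards [hl] with n hn θ hθ
  have hθε := Metric.ball_subset_ball (min_le_left _ _) hθ
  have hd : M * dist θ θ₀ ≤ δ := by
    have : dist θ θ₀ < δ / M := (Metric.mem_ball.1 hθ).trans_le (min_le_right _ _)
    rw [lt_div_iff₀ hM] at this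
    linarith
  have h1 := (abs_le.1 (hn θ hθε)).1
  rw [likelihood_eq_exp fun i => hs.1 i θ (hεΘ hθε), likelihood_eq_exp fun i => hs.1 i θ₀ h₀,
    ← Real.exp_add, Real.exp_le_exp]
  nlinarith [mul_le_mul_of_nonneg_left (h1.trans' (neg_le_neg hd))
    (Nat.cast_nonneg (α := ℝ) n)]

/-! ### Concentration of integrals against the likelihood -/

/-- A sequence of positive continuous functions on `Θ` which, on the exponential scale, concentrate
at `θ₀`: they are exponentially small away from `θ₀`, relative to each earlier function of the
sequence, and decrease near `θ₀` only at an arbitrarily small exponential rate. -/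
structure ConcentratesAt {p : ℕ} (Θ : Set (Eucl p)) (L : ℕ → Eucl p → ℝ) (θ₀ : Eucl p) :
    Prop where
  pos : ∀ n, ∀ θ ∈ Θ, 0 < L n θ
  continuousOn : ∀ n, ContinuousOn (L n) Θ
  far : ∀ r > 0, ∃ c > 0, ∀ m, ∃ C, ∀ᶠ n : ℕ in atTop, ∀ θ ∈ Θ \ Metric.ball θ₀ r,
    L n θ ≤ C * Real.exp (-c * n) * L n θ₀ * L m θ
  near : ∀ δ > 0, ∃ r > 0, ∀ᶠ n : ℕ in atTop, ∀ θ ∈ Metric.ball θ₀ r,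
    Real.exp (-δ * n) * L n θ₀ ≤ L n θ

namespace ConcentratesAt

variable {p : ℕ} {Θ : Set (Eucl p)} {L : ℕ → Eucl p → ℝ} {θ₀ : Eucl p} {r₀ : ℝ}

theorem integrableOn_ball (hL : ConcentratesAt Θ L θ₀) (hr₀ : Metric.closedBall θ₀ r₀ ⊆ Θ)
    (n : ℕ) : IntegrableOn (L n) (Metric.ball θ₀ r₀) :=
  (((hL.continuousOn n).mono hr₀).integrableOn_compact (isCompact_closedBall _ _)).mono_set
    Metric.ball_subset_closedBall

theorem exists_le_integral_ball (hL : ConcentratesAt Θ L θ₀) (h₀ : 0 < r₀)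
    (hr₀ : Metric.closedBall θ₀ r₀ ⊆ Θ) {δ : ℝ} (hδ : 0 < δ) :
    ∃ v > 0, ∀ᶠ n : ℕ in atTop,
      v * Real.exp (-δ * n) * L n θ₀ ≤ ∫ θ in Metric.ball θ₀ r₀, L n θ := by
  obtain ⟨r, hr, hn⟩ := hL.near δ hδ
  have hm : 0 < min r r₀ := lt_min hr h₀
  refine ⟨volume.real (Metric.ball θ₀ (min r r₀)),
    ENNReal.toReal_pos (Metric.measure_ball_pos _ _ hm).ne' measure_ball_lt_top.ne, ?_⟩
  filter_upwards [hn] with n hn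
  have hsub : Metric.ball θ₀ (min r r₀) ⊆ Metric.ball θ₀ r₀ :=
    Metric.ball_subset_ball (min_le_right _ _)
  have hint := hL.integrableOn_ball hr₀ n
  calc volume.real (Metric.ball θ₀ (min r r₀)) * Real.exp (-δ * n) * L n θ₀
      = ∫ _ in Metric.ball θ₀ (min r r₀), Real.exp (-δ * n) * L n θ₀ := by
        rw [setIntegral_const, smul_eq_mul, mul_assoc]
    _ ≤ ∫ θ in Metric.ball θ₀ (min r r₀), L n θ :=
        setIntegral_mono_on (integrableOn_const measure_ball_lt_top.ne) (hint.mono_set hsub)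
          measurableSet_ball fun θ hθ => hn θ (Metric.ball_subset_ball (min_le_left _ _) hθ)
    _ ≤ ∫ θ in Metric.ball θ₀ r₀, L n θ :=
        setIntegral_mono_set hint
          (ae_restrict_of_forall_mem measurableSet_ball fun θ hθ =>
            (hL.pos n θ (hr₀ (Metric.ball_subset_closedBall hθ))).le)
          (LE.le.eventuallyLE hsub)

theorem eventually_integral_ball_pos (hL : ConcentratesAt Θ L θ₀) (h₀ : 0 < r₀)
    (hr₀ : Metric.closedBall θ₀ r₀ ⊆ Θ) :
    ∀ᶠ n : ℕ in atTop, 0 < ∫ θ in Metric.ball θ₀ r₀, L n θ := by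
  obtain ⟨v, hv, h⟩ := hL.exists_le_integral_ball h₀ hr₀ one_pos
  filter_upwards [h] with n hn
  have := hL.pos n θ₀ (hr₀ (Metric.mem_closedBall_self h₀.le))
  exact hn.trans_lt' (by positivity)

/-- The mass outside a ball around `θ₀` is negligible, for any weight that is integrable against
one of the functions of the sequence. -/
theorem tendsto_integral_diff_ball (hL : ConcentratesAt Θ L θ₀) (h₀ : 0 < r₀)
    (hr₀ : Metric.closedBall θ₀ r₀ ⊆ Θ) {S : Set (Eucl p)} (hS : MeasurableSet S) (hSΘ : S ⊆ Θ)
    {h : Eucl p → ℝ} (hh : AEMeasurable h (volume.restrict S)) (hh0 : ∀ θ ∈ S, 0 ≤ h θ) {m : ℕ}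
    (hint : IntegrableOn (fun θ => L m θ * h θ) S) {r : ℝ} (hr : 0 < r) :
    (∀ᶠ n : ℕ in atTop, IntegrableOn (fun θ => L n θ * h θ) (S \ Metric.ball θ₀ r)) ∧
    Tendsto (fun n => (∫ θ in S \ Metric.ball θ₀ r, L n θ * h θ)
      / ∫ θ in Metric.ball θ₀ r₀, L n θ) atTop (𝓝 0) := by
  obtain ⟨c, hc, hfar⟩ := hL.far r hr
  obtain ⟨C, hC⟩ := hfar m
  obtain ⟨v, hv, hlow⟩ := hL.exists_le_integral_ball h₀ hr₀ (half_pos hc)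
  have hSm : MeasurableSet (S \ Metric.ball θ₀ r) := hS.diff measurableSet_ball
  have hθ₀ : θ₀ ∈ Θ := hr₀ (Metric.mem_closedBall_self h₀.le)
  have hintd := hint.mono_set (Set.sdiff_subset (t := Metric.ball θ₀ r))
  have hbound : ∀ᶠ n : ℕ in atTop, ∀ θ ∈ S \ Metric.ball θ₀ r,
      L n θ * h θ ≤ C * Real.exp (-c * n) * L n θ₀ * (L m θ * h θ) := by
    filter_upwards [hC] with n hn θ hθ
    rw [← mul_assoc]
    exact mul_le_mul_of_nonneg_right (hn θ ⟨hSΘ hθ.1, hθ.2⟩) (hh0 θ hθ.1)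
  have hnn : ∀ n, ∀ θ ∈ S \ Metric.ball θ₀ r, 0 ≤ L n θ * h θ := fun n θ hθ =>
    mul_nonneg (hL.pos n θ (hSΘ hθ.1)).le (hh0 θ hθ.1)
  have hinte : ∀ᶠ n : ℕ in atTop, IntegrableOn (fun θ => L n θ * h θ) (S \ Metric.ball θ₀ r) := by
    filter_upwards [hbound] with n hn
    refine (hintd.const_mul (C * Real.exp (-c * n) * L n θ₀)).mono' ?_ ?_
    · refine (AEMeasurable.mul ?_ (hh.mono_set Set.sdiff_subset)).aestronglyMeasurable
      exact ((hL.continuousOn n).mono (Set.sdiff_subset.trans hSΘ)).aemeasurable hSm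
    · refine ae_restrict_of_forall_mem hSm fun θ hθ => ?_
      rw [Real.norm_of_nonneg (hnn n θ hθ)]
      exact hn θ hθ
  refine ⟨hinte, ?_⟩
  set J := ∫ θ in S \ Metric.ball θ₀ r, L m θ * h θ with hJ
  have hlim : Tendsto (fun n : ℕ => |C| * J / v * Real.exp (-(c / 2) * n)) atTop (𝓝 0) := by
    rw [← mul_zero (|C| * J / v)]
    refine (Real.tendsto_exp_atBot.comp ?_).const_mul _
    exact tendsto_natCast_atTop_atTop.const_mul_atTop_of_neg (by linarith)
  refine squeeze_zero' ?_ ?_ hlim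
  · filter_upwards [hL.eventually_integral_ball_pos h₀ hr₀] with n hn
    exact div_nonneg (setIntegral_nonneg hSm (hnn n)) hn.le
  · filter_upwards [hbound, hinte, hlow, hL.eventually_integral_ball_pos h₀ hr₀]
      with n hb hi hl hp
    have hJ0 : 0 ≤ J := setIntegral_nonneg hSm (hnn m)
    have hL0 := hL.pos n θ₀ hθ₀
    rw [div_le_iff₀ hp]
    calc ∫ θ in S \ Metric.ball θ₀ r, L n θ * h θ
        ≤ ∫ θ in S \ Metric.ball θ₀ r, C * Real.exp (-c * n) * L n θ₀ * (L m θ * h θ) :=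
          setIntegral_mono_on hi (hintd.const_mul _) hSm hb
      _ = C * (Real.exp (-c * n) * L n θ₀ * J) := by rw [integral_const_mul, hJ]; ring
      _ ≤ |C| * (Real.exp (-c * n) * L n θ₀ * J) := by gcongr; exact le_abs_self C
      _ = |C| * J / v * Real.exp (-(c / 2) * n) * (v * Real.exp (-(c / 2) * n) * L n θ₀) := by
          have : Real.exp (-c * n) = Real.exp (-(c / 2) * n) * Real.exp (-(c / 2) * n) := by
            rw [← Real.exp_add]
            congr 1
            ring
          rw [this]
          field_simp
      _ ≤ _ := by gcongr

/-- Integrals of a weight against the sequence are asymptotic to the value of the weight at `θ₀`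
times the mass of a fixed ball. The normalizing mass does not depend on the weight, so it cancels
in ratios of two such integrals. -/
theorem tendsto_integral_div (hL : ConcentratesAt Θ L θ₀) (hΘ : IsOpen Θ) (h₀ : 0 < r₀)
    (hr₀ : Metric.closedBall θ₀ r₀ ⊆ Θ) {h : Eucl p → ℝ}
    (hh : AEMeasurable h (volume.restrict Θ)) (hh0 : ∀ θ ∈ Θ, 0 ≤ h θ) (hc : ContinuousAt h θ₀)
    (hint : ∃ m, IntegrableOn (fun θ => L m θ * h θ) Θ) :
    (∀ᶠ n : ℕ in atTop, IntegrableOn (fun θ => L n θ * h θ) Θ) ∧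
    Tendsto (fun n => (∫ θ in Θ, L n θ * h θ) / ∫ θ in Metric.ball θ₀ r₀, L n θ)
      atTop (𝓝 (h θ₀)) := by
  obtain ⟨m, hint⟩ := hint
  have hball : Metric.ball θ₀ r₀ ⊆ Θ := Metric.ball_subset_closedBall.trans hr₀
  have hθ₀ : θ₀ ∈ Θ := hball (Metric.mem_ball_self h₀)
  have key : ∀ η > 0, ∃ r, 0 < r ∧ r ≤ r₀ ∧ (∀ θ ∈ Metric.ball θ₀ r, |h θ - h θ₀| ≤ η) ∧
      ∀ n, IntegrableOn (fun θ => L n θ * h θ) (Metric.ball θ₀ r) := by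
    intro η hη
    obtain ⟨s, hs, hsη⟩ := Metric.continuousAt_iff.1 hc η hη
    have hsub : Metric.ball θ₀ (min s r₀) ⊆ Metric.ball θ₀ r₀ :=
      Metric.ball_subset_ball (min_le_right _ _)
    have hclose : ∀ θ ∈ Metric.ball θ₀ (min s r₀), |h θ - h θ₀| ≤ η := fun θ hθ => by
      have := hsη (Metric.ball_subset_ball (min_le_left _ _) hθ : dist θ θ₀ < s)
      rw [Real.dist_eq] at this
      exact this.le
    refine ⟨min s r₀, lt_min hs h₀, min_le_right _ _, hclose, fun n => ?_⟩
    refine ((hL.integrableOn_ball hr₀ n).mono_set hsub).mul_bdd (c := η + |h θ₀|)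
      (hh.mono_set (hsub.trans hball)).aestronglyMeasurable
      (ae_restrict_of_forall_mem measurableSet_ball fun θ hθ => ?_)
    rw [Real.norm_eq_abs]
    calc |h θ| = |(h θ - h θ₀) + h θ₀| := by rw [sub_add_cancel]
      _ ≤ |h θ - h θ₀| + |h θ₀| := abs_add_le _ _
      _ ≤ η + |h θ₀| := by gcongr; exact hclose θ hθ
  have htail := fun (r : ℝ) (hr : 0 < r) =>
    hL.tendsto_integral_diff_ball h₀ hr₀ hΘ.measurableSet subset_rfl hh hh0 hint hr
  have htail' := fun (r : ℝ) (hr : 0 < r) =>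
    hL.tendsto_integral_diff_ball h₀ hr₀ (measurableSet_ball (x := θ₀) (ε := r₀)) hball
      (h := fun _ => 1) aemeasurable_const (fun _ _ => zero_le_one) (m := 0)
      (by simpa using hL.integrableOn_ball hr₀ 0) hr
  have hinte : ∀ᶠ n : ℕ in atTop, IntegrableOn (fun θ => L n θ * h θ) Θ := by
    obtain ⟨r, hr, hrr, -, hi⟩ := key 1 one_pos
    filter_upwards [(htail r hr).1] with n hn
    exact (hn.union (hi n)).mono_set (by rw [Set.sdiff_union_self]; exact Set.subset_union_left)
  refine ⟨hinte, Metric.tendsto_nhds.2 fun ε hε => ?_⟩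
  obtain ⟨r, hr, hrr, hclose, hi⟩ := key (ε / 2) (half_pos hε)
  have hsub : Metric.ball θ₀ r ⊆ Metric.ball θ₀ r₀ := Metric.ball_subset_ball hrr
  have hlim := (htail r hr).2.add ((htail' r hr).2.const_mul (h θ₀))
  rw [mul_zero, add_zero] at hlim
  filter_upwards [hinte, hL.eventually_integral_ball_pos h₀ hr₀,
    hlim.eventually_lt_const (half_pos hε)] with n hn hA hT
  simp only [mul_one] at hT
  have hLb := hL.integrableOn_ball hr₀ n
  have s1 := setIntegral_sdiff (measurableSet_ball (x := θ₀) (ε := r)) hn (hsub.trans hball)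
  have s2 := setIntegral_sdiff (measurableSet_ball (x := θ₀) (ε := r)) hLb hsub
  have s3 : |(∫ θ in Metric.ball θ₀ r, L n θ * h θ) - h θ₀ * ∫ θ in Metric.ball θ₀ r, L n θ|
      ≤ ε / 2 * ∫ θ in Metric.ball θ₀ r, L n θ := by
    have hLr := hLb.mono_set hsub
    rw [← integral_const_mul, ← integral_const_mul, ← integral_sub (hi n) (hLr.const_mul _),
      ← Real.norm_eq_abs]
    refine norm_integral_le_of_norm_le (hLr.const_mul _)
      (ae_restrict_of_forall_mem measurableSet_ball fun θ hθ => ?_)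
    have hp := hL.pos n θ (hball (hsub hθ))
    rw [mul_comm (h θ₀), ← mul_sub, norm_mul, Real.norm_of_nonneg hp.le, mul_comm]
    exact mul_le_mul_of_nonneg_right (hclose θ hθ) hp.le
  have s4 : 0 ≤ ∫ θ in Θ \ Metric.ball θ₀ r, L n θ * h θ :=
    setIntegral_nonneg (hΘ.measurableSet.diff measurableSet_ball) fun θ hθ =>
      mul_nonneg (hL.pos n θ hθ.1).le (hh0 θ hθ.1)
  have s5 : 0 ≤ ∫ θ in Metric.ball θ₀ r₀ \ Metric.ball θ₀ r, L n θ :=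
    setIntegral_nonneg (measurableSet_ball.diff measurableSet_ball) fun θ hθ =>
      (hL.pos n θ (hball hθ.1)).le
  set A := ∫ θ in Metric.ball θ₀ r₀, L n θ
  have hT' : (∫ θ in Θ \ Metric.ball θ₀ r, L n θ * h θ)
      + h θ₀ * (∫ θ in Metric.ball θ₀ r₀ \ Metric.ball θ₀ r, L n θ) < ε / 2 * A := by
    rwa [← mul_div_assoc, ← add_div, div_lt_iff₀ hA] at hT
  have s6 := mul_nonneg (hh0 θ₀ hθ₀) s5
  rw [Real.dist_eq, div_sub' hA.ne', abs_div, abs_of_pos hA, div_lt_iff₀ hA]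
  have s7 : ε / 2 * (∫ θ in Metric.ball θ₀ r, L n θ) ≤ ε / 2 * A :=
    mul_le_mul_of_nonneg_left (by linarith) (half_pos hε).le
  have s8 : h θ₀ * (∫ θ in Metric.ball θ₀ r₀ \ Metric.ball θ₀ r, L n θ)
      = h θ₀ * A - h θ₀ * ∫ θ in Metric.ball θ₀ r, L n θ := by rw [s2, mul_sub]
  rw [abs_le] at s3
  rw [abs_lt]
  constructor <;> linarith [s3.1, s3.2]

end ConcentratesAt

/-! ### Measurability of the Bayes factor in the data -/

/-- The marginal likelihood is a measurable function of the data, up to a null set. The densities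
are Carathéodory functions (continuous in the parameter, measurable in the observation) once they
are modified on a null set of observations, hence jointly measurable. -/
theorem aestronglyMeasurable_marginalLikelihood {p k : ℕ} {Θ : Set (Eucl p)}
    {f : Eucl p → Eucl k → ℝ} (hf : IsParametricFamily Θ f) {θ₀ : Eucl p} (h₀ : θ₀ ∈ Θ)
    (hreg : IsLaplaceRegularAt Θ f θ₀) {π : Eucl p → ℝ}
    (hπ : AEMeasurable π (volume.restrict Θ)) (n : ℕ) :
    AEStronglyMeasurable (marginalLikelihood Θ f π n) (seqLaw f θ₀) := by
  classical
  have := isProbabilityMeasure_law hf h₀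
  have hΘ := hf.isOpen.measurableSet
  obtain ⟨N, hsub, hNm, hN0⟩ := exists_measurable_superset_of_null (ae_iff.1 hreg.smooth)
  let g : Θ → Eucl k → ℝ := fun θ x => if x ∈ N then 1 else f θ x
  have hgc : ∀ x, Continuous fun θ => g θ x := fun x => by
    by_cases hx : x ∈ N
    · simp only [g, if_pos hx]
      exact continuous_const
    · simp only [g, if_neg hx]
      have hx' : (∀ θ ∈ Θ, 0 < f θ x) ∧ ContDiffOn ℝ 6 (fun θ => Real.log (f θ x)) Θ := by
        by_contra hcon
        exact hx (hsub hcon)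
      have h1 : ContinuousOn (fun θ => f θ x) Θ :=
        hx'.2.continuousOn.rexp.congr fun θ hθ => (Real.exp_log (hx'.1 θ hθ)).symm
      exact continuousOn_iff_continuous_domRestrict.1 h1
  have hgm : Measurable (Function.uncurry g) :=
    measurable_uncurry_of_continuous_of_measurable hgc fun θ =>
      Measurable.ite hNm measurable_const (hf.measurable θ θ.2)
  have hF : StronglyMeasurable fun z : (ℕ → Eucl k) × Θ =>
      (∏ i ∈ Finset.range n, g z.2 (z.1 i)) * hπ.mk π z.2 := by
    refine Measurable.stronglyMeasurable (Measurable.mul ?_ ?_)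
    · exact Finset.measurable_fun_prod _ fun i _ =>
        hgm.comp (measurable_snd.prodMk ((measurable_pi_apply i).comp measurable_fst))
    · exact hπ.measurable_mk.comp (measurable_subtype_coe.comp measurable_snd)
  have hgood : ∀ᵐ x ∂(law f θ₀), x ∉ N := measure_eq_zero_iff_ae_notMem.1 hN0
  have : LocallyCompactSpace Θ := hf.isOpen.locallyCompactSpace
  have : IsFiniteMeasureOnCompacts (volume.comap Subtype.val : Measure Θ) :=
    .comap' volume continuous_subtype_val (MeasurableEmbedding.subtype_coe hΘ)
  refine ⟨fun y => ∫ θ : Θ, (∏ i ∈ Finset.range n, g θ (y i)) * hπ.mk π θ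
    ∂(volume.comap Subtype.val), hF.integral_prod_right', ?_⟩
  filter_upwards [ae_seqLaw_forall hgood] with y hy
  calc marginalLikelihood Θ f π n y
      = ∫ θ in Θ, likelihood f n y θ * hπ.mk π θ :=
        integral_congr_ae (hπ.ae_eq_mk.mono fun θ hθ => by simp only [hθ])
    _ = ∫ θ : Θ, likelihood f n y θ * hπ.mk π θ ∂(volume.comap Subtype.val) :=
        (integral_subtype_comap hΘ fun θ => likelihood f n y θ * hπ.mk π θ).symm
    _ = _ := by
        simp only [likelihood, g]
        refine integral_congr_ae (ae_of_all _ fun θ => ?_)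
        simp only [if_neg (hy _)]

/-! ### The limit of the Bayes factor -/

/-- Almost surely the likelihoods concentrate at the data-governing parameter. -/
theorem ae_concentratesAt_likelihood {p k : ℕ} {Θ : Set (Eucl p)} {f : Eucl p → Eucl k → ℝ}
    (hf : IsParametricFamily Θ f) (hid : IsIdentifiable Θ f) {θ₀ : Eucl p} (h₀ : θ₀ ∈ Θ)
    (hreg : IsLaplaceRegularAt Θ f θ₀) :
    ∀ᵐ y ∂(seqLaw f θ₀), ConcentratesAt Θ (fun n => likelihood f n y) θ₀ := by
  have := isProbabilityMeasure_law hf h₀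
  filter_upwards [hreg.ae_smooth, ae_forall_eventually_likelihood_le hf hid h₀ hreg,
    ae_forall_eventually_le_likelihood hf h₀ hreg] with y hs hfar hnear
  exact ⟨fun n θ hθ => likelihood_pos fun i => hs.1 i θ hθ,
    continuousOn_likelihood hs.1 hs.2, hfar, hnear⟩

theorem ConcentratesAt.tendsto_bayesFactor {p k : ℕ} {Θ : Set (Eucl p)} {f : Eucl p → Eucl k → ℝ}
    {θ₀ : Eucl p} {y : ℕ → Eucl k} (hL : ConcentratesAt Θ (fun n => likelihood f n y) θ₀)
    (hΘ : IsOpen Θ) (h₀ : θ₀ ∈ Θ) {π π' : Eucl p → ℝ}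
    (hπ : AEMeasurable π (volume.restrict Θ)) (hπ' : AEMeasurable π' (volume.restrict Θ))
    (hnn : ∀ θ ∈ Θ, 0 ≤ π θ) (hnn' : ∀ θ ∈ Θ, 0 ≤ π' θ)
    (hc : ContinuousAt π θ₀) (hc' : ContinuousAt π' θ₀) (hpos : 0 < π θ₀) (hpos' : 0 < π' θ₀)
    (hfin : ∃ n, IntegrableOn (fun θ => likelihood f n y θ * π θ) Θ)
    (hfin' : ∃ n, IntegrableOn (fun θ => likelihood f n y θ * π' θ) Θ) :
    (∀ᶠ n : ℕ in atTop, HasProperMarginal Θ f π n y ∧ HasProperMarginal Θ f π' n y) ∧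
    Tendsto (fun n => bayesFactor Θ f π π' n y) atTop (𝓝 (π θ₀ / π' θ₀)) := by
  obtain ⟨r, hr, hrΘ⟩ := Metric.nhds_basis_closedBall.mem_iff.1 (hΘ.mem_nhds h₀)
  obtain ⟨hi, ht⟩ := hL.tendsto_integral_div hΘ hr hrΘ hπ hnn hc hfin
  obtain ⟨hi', ht'⟩ := hL.tendsto_integral_div hΘ hr hrΘ hπ' hnn' hc' hfin'
  have hA := hL.eventually_integral_ball_pos hr hrΘ
  constructor
  · filter_upwards [hi, hi', hA, ht.eventually_const_lt hpos, ht'.eventually_const_lt hpos']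
      with n h1 h2 h3 h4 h5
    exact ⟨⟨h1, (div_pos_iff_of_pos_right h3).1 h4⟩, ⟨h2, (div_pos_iff_of_pos_right h3).1 h5⟩⟩
  · refine (ht.div ht' hpos'.ne').congr' ?_
    filter_upwards [hA] with n hn
    exact div_div_div_cancel_right₀ hn.ne' _ _

/-- A sequence that converges in probability to a nonzero constant does not converge to zero. -/
theorem not_tendstoInMeasure_zero {Ω : Type*} [MeasurableSpace Ω] {P : Measure Ω}
    [IsProbabilityMeasure P] {X : ℕ → Ω → ℝ} {a : ℝ} (ha : a ≠ 0)
    (hX : TendstoInMeasure P X atTop fun _ => a) :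
    ¬ TendstoInMeasure P X atTop fun _ => 0 := fun h => by
  obtain ⟨_, hω⟩ := (tendstoInMeasure_ae_unique hX h).exists
  exact ha hω

theorem theorem1 {p k : ℕ} {Θ : Set (Eucl p)} {f : Eucl p → Eucl k → ℝ}
    (hf : IsParametricFamily Θ f) (hid : IsIdentifiable Θ f) (hreg : IsLaplaceRegular Θ f)
    {θ₀ : Eucl p} (hθ₀ : θ₀ ∈ Θ)
    {Ω : Type*} [MeasurableSpace Ω] (P : Measure Ω) [IsProbabilityMeasure P]
    (Y : ℕ → Ω → Eucl k) (hY : ∀ i, Measurable (Y i)) (hindep : iIndepFun Y P)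
    (hlaw : ∀ i, P.map (Y i) = law f θ₀)
    (π₁ π₀ : Eucl p → ℝ)
    (hπ₁ : IsPriorDensity Θ f θ₀ π₁) (hπ₀ : IsPriorDensity Θ f θ₀ π₀)
    (hpos₁ : 0 < π₁ θ₀) (hpos₀ : 0 < π₀ θ₀)
    (hC₁ : ContDiffAt ℝ 4 π₁ θ₀) (hC₀ : ContDiffAt ℝ 4 π₀ θ₀) :
    -- almost surely, both marginal likelihoods are finite and positive from some `n` on
    (∀ᵐ ω ∂P, ∀ᶠ n : ℕ in atTop,
      HasProperMarginal Θ f π₁ n (fun i => Y i ω) ∧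
      HasProperMarginal Θ f π₀ n (fun i => Y i ω)) ∧
    -- the peri-null Bayes factor converges in probability to the ratio of the prior densities
    TendstoInMeasure P (fun (n : ℕ) ω => bayesFactor Θ f π₁ π₀ n (fun i => Y i ω)) atTop
      (fun _ => π₁ θ₀ / π₀ θ₀) ∧
    -- inconsistency: neither the Bayes factor nor its reciprocal tends to zero in probability
    ¬ TendstoInMeasure P (fun (n : ℕ) ω => bayesFactor Θ f π₁ π₀ n (fun i => Y i ω)) atTop
      (fun _ => 0) ∧
    ¬ TendstoInMeasure P (fun (n : ℕ) ω => bayesFactor Θ f π₀ π₁ n (fun i => Y i ω)) atTop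
      (fun _ => 0) := by
  have hmap : MeasurePreserving (fun ω i => Y i ω) P (seqLaw f θ₀) :=
    ⟨measurable_pi_iff.2 hY, by
      rw [hindep.map_fun_eq_infinitePi_map hY, seqLaw, funext hlaw]⟩
  have main : ∀ {π π' : Eucl p → ℝ}, IsPriorDensity Θ f θ₀ π → IsPriorDensity Θ f θ₀ π' →
      0 < π θ₀ → 0 < π' θ₀ → ContinuousAt π θ₀ → ContinuousAt π' θ₀ →
      (∀ᵐ ω ∂P, ∀ᶠ n : ℕ in atTop, HasProperMarginal Θ f π n (fun i => Y i ω) ∧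
        HasProperMarginal Θ f π' n (fun i => Y i ω)) ∧
      TendstoInMeasure P (fun (n : ℕ) ω => bayesFactor Θ f π π' n (fun i => Y i ω)) atTop
        (fun _ => π θ₀ / π' θ₀) := by
    intro π π' hπ hπ' hpos hpos' hc hc'
    have hae : ∀ᵐ y ∂(seqLaw f θ₀),
        (∀ᶠ n : ℕ in atTop, HasProperMarginal Θ f π n y ∧ HasProperMarginal Θ f π' n y) ∧
        Tendsto (fun n => bayesFactor Θ f π π' n y) atTop (𝓝 (π θ₀ / π' θ₀)) := by
      filter_upwards [ae_concentratesAt_likelihood hf hid hθ₀ (hreg θ₀ hθ₀), hπ.finite_marginal,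
        hπ'.finite_marginal] with y hL hfin hfin'
      exact hL.tendsto_bayesFactor hf.isOpen hθ₀ hπ.aemeasurable hπ'.aemeasurable hπ.nonneg
        hπ'.nonneg hc hc' hpos hpos' hfin hfin'
    have haeP := hmap.quasiMeasurePreserving.ae hae
    refine ⟨haeP.mono fun _ h => h.1,
      tendstoInMeasure_of_tendsto_ae (fun n => ?_) (haeP.mono fun _ h => h.2)⟩
    have hbf : AEStronglyMeasurable (bayesFactor Θ f π π' n) (seqLaw f θ₀) :=
      ((aestronglyMeasurable_marginalLikelihood hf hθ₀ (hreg θ₀ hθ₀) hπ.aemeasurable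
          n).aemeasurable.div
        (aestronglyMeasurable_marginalLikelihood hf hθ₀ (hreg θ₀ hθ₀) hπ'.aemeasurable
          n).aemeasurable).aestronglyMeasurable
    exact hbf.comp_measurePreserving hmap
  obtain ⟨hprop, hlim⟩ := main hπ₁ hπ₀ hpos₁ hpos₀ hC₁.continuousAt hC₀.continuousAt
  obtain ⟨-, hlim'⟩ := main hπ₀ hπ₁ hpos₀ hpos₁ hC₀.continuousAt hC₁.continuousAt
  exact ⟨hprop, hlim, not_tendstoInMeasure_zero (div_pos hpos₁ hpos₀).ne' hlim,
    not_tendstoInMeasure_zero (div_pos hpos₀ hpos₁).ne' hlim'⟩
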